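/- Let $p>3$ be a prime, and let $\mathbb Z_p$ denote the ring of rational numbers whose denominator is not divisible by $p$. Then $$\sum_{k=0}^{(p-1)/2}\frac{k\binom{2k}{k}\binom{3k}{k}}{27^k}\equiv-\left(\frac p3\right)\frac{4-3p+2^{p+2}}{54}\pmod{p^2},$$ where $\left(\frac p3\right)$ is the Legendre symbol. The congruence is understood in $\mathbb Z_p$: both sides lie in $\mathbb Z_p$ and their difference belongs to $p^2\mathbb Z_p$. -/

import Mathlib

/-- `x` lies in the ring of rational numbers whose denominator is not divisible by `p`. -/
def IsPIntegral (p : ℕ) (x : ℚ) : Prop := ¬ p ∣ x.den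

/-- `x ≡ y (mod p ^ n)` in the ring of rational numbers whose denominator is not divisible
by `p`: both sides lie in that ring, and they differ by `p ^ n` times an element of it. -/
def PCongr (p n : ℕ) (x y : ℚ) : Prop :=
  IsPIntegral p x ∧ IsPIntegral p y ∧ ∃ z : ℚ, IsPIntegral p z ∧ x - y = (p : ℚ) ^ n * z

section PIntegral

variable {p : ℕ}

theorem isPIntegral_div (a : ℤ) {b : ℤ} (hb : ¬ (p : ℤ) ∣ b) :
    IsPIntegral p ((a : ℚ) / b) := by
  intro h
  apply hb
  have h1 : ((((a : ℚ) / b).den : ℕ) : ℤ) ∣ b := by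
    rw [← Rat.divInt_eq_div]
    exact Rat.den_dvd a b
  exact (Int.natCast_dvd_natCast.mpr h).trans h1

theorem isPIntegral_iff (x : ℚ) :
    IsPIntegral p x ↔ ∃ a b : ℤ, ¬ (p : ℤ) ∣ b ∧ x = a / b := by
  constructor
  · intro h
    exact ⟨x.num, x.den, fun h' => h (Int.natCast_dvd_natCast.mp h'), by
      rw [Int.cast_natCast]; exact (Rat.num_div_den x).symm⟩
  · rintro ⟨a, b, hb, rfl⟩
    exact isPIntegral_div a hb

theorem isPIntegral_intCast (hp : p.Prime) (a : ℤ) : IsPIntegral p (a : ℚ) := by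
  simpa [IsPIntegral] using hp.one_lt.ne'

theorem isPIntegral_natCast (hp : p.Prime) (a : ℕ) : IsPIntegral p (a : ℚ) := by
  simpa using isPIntegral_intCast hp (a : ℤ)

theorem IsPIntegral.add (hp : p.Prime) {x y : ℚ} (hx : IsPIntegral p x) (hy : IsPIntegral p y) :
    IsPIntegral p (x + y) := by
  obtain ⟨a, b, hb, rfl⟩ := (isPIntegral_iff _).1 hx
  obtain ⟨c, d, hd, rfl⟩ := (isPIntegral_iff _).1 hy
  refine (isPIntegral_iff _).2 ⟨a * d + b * c, b * d, ?_, ?_⟩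
  · intro h
    exact ((Nat.prime_iff_prime_int.mp hp).dvd_or_dvd h).elim hb hd
  · have hb0 : (b : ℚ) ≠ 0 := by rintro h; exact hb (by simp [Int.cast_eq_zero.mp h])
    have hd0 : (d : ℚ) ≠ 0 := by rintro h; exact hd (by simp [Int.cast_eq_zero.mp h])
    push_cast
    exact div_add_div _ _ hb0 hd0

theorem IsPIntegral.mul (hp : p.Prime) {x y : ℚ} (hx : IsPIntegral p x) (hy : IsPIntegral p y) :
    IsPIntegral p (x * y) := by
  obtain ⟨a, b, hb, rfl⟩ := (isPIntegral_iff _).1 hx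
  obtain ⟨c, d, hd, rfl⟩ := (isPIntegral_iff _).1 hy
  refine (isPIntegral_iff _).2 ⟨a * c, b * d, ?_, ?_⟩
  · intro h
    exact ((Nat.prime_iff_prime_int.mp hp).dvd_or_dvd h).elim hb hd
  · push_cast
    exact div_mul_div_comm _ _ _ _

theorem IsPIntegral.neg {x : ℚ} (hx : IsPIntegral p x) : IsPIntegral p (-x) := by
  simpa [IsPIntegral] using hx

/-- `x` is `p ^ n` times a `p`-integral rational number. -/
def PDvd (p n : ℕ) (x : ℚ) : Prop := ∃ z : ℚ, IsPIntegral p z ∧ x = (p : ℚ) ^ n * z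

theorem PDvd.add (hp : p.Prime) {n : ℕ} {x y : ℚ} (hx : PDvd p n x) (hy : PDvd p n y) :
    PDvd p n (x + y) := by
  obtain ⟨a, ha, rfl⟩ := hx
  obtain ⟨b, hb, rfl⟩ := hy
  exact ⟨a + b, ha.add hp hb, by ring⟩

theorem PDvd.neg {n : ℕ} {x : ℚ} (hx : PDvd p n x) : PDvd p n (-x) := by
  obtain ⟨a, ha, rfl⟩ := hx
  exact ⟨-a, ha.neg, by ring⟩

theorem PDvd.mul (hp : p.Prime) {n m : ℕ} {x y : ℚ} (hx : PDvd p n x) (hy : PDvd p m y) :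
    PDvd p (n + m) (x * y) := by
  obtain ⟨a, ha, rfl⟩ := hx
  obtain ⟨b, hb, rfl⟩ := hy
  exact ⟨a * b, ha.mul hp hb, by ring⟩

theorem PDvd.mul_left (hp : p.Prime) {n : ℕ} {x y : ℚ} (hy : IsPIntegral p y) (hx : PDvd p n x) :
    PDvd p n (y * x) := by
  obtain ⟨a, ha, rfl⟩ := hx
  exact ⟨y * a, hy.mul hp ha, by ring⟩

theorem PDvd.isPIntegral (hp : p.Prime) {n : ℕ} {x : ℚ} (hx : PDvd p n x) : IsPIntegral p x := by
  obtain ⟨a, ha, rfl⟩ := hx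
  simpa using (isPIntegral_natCast hp (p ^ n)).mul hp ha

theorem pDvd_zero (hp : p.Prime) (n : ℕ) : PDvd p n 0 :=
  ⟨0, by simpa using isPIntegral_intCast hp 0, by simp⟩

theorem pDvd_one_self (hp : p.Prime) : PDvd p 1 (p : ℚ) :=
  ⟨1, by simpa using isPIntegral_intCast hp 1, by simp⟩

theorem PDvd.sum (hp : p.Prime) {n : ℕ} {ι : Type*} (s : Finset ι) (f : ι → ℚ)
    (h : ∀ i ∈ s, PDvd p n (f i)) : PDvd p n (∑ i ∈ s, f i) :=
  Finset.sum_induction f (PDvd p n) (fun _ _ hx hy => hx.add hp hy) (pDvd_zero hp n) h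

theorem not_dvd_of_pos_of_lt {k : ℕ} (h0 : 0 < k) (h1 : k < p) : ¬ (p : ℤ) ∣ (k : ℤ) := by
  rw [Int.natCast_dvd_natCast]
  exact Nat.not_dvd_of_pos_of_lt h0 h1

theorem isPIntegral_inv_natCast {k : ℕ} (h0 : 0 < k) (h1 : k < p) :
    IsPIntegral p ((k : ℚ)⁻¹) := by
  have := isPIntegral_div 1 (not_dvd_of_pos_of_lt h0 h1)
  simpa using this

end PIntegral

/-- The value `(-1) ^ k * (x choose k) * (x + k choose k)` at a rational number `x`. -/
def legendreTerm (k : ℕ) (x : ℚ) : ℚ :=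
  ∏ j ∈ Finset.range k, ((j - x) * (x + j + 1) / ((j : ℚ) + 1) ^ 2)

theorem legendreTerm_zero (x : ℚ) : legendreTerm 0 x = 1 := by simp [legendreTerm]

theorem legendreTerm_succ (k : ℕ) (x : ℚ) :
    legendreTerm (k + 1) x =
      legendreTerm k x * ((k - x) * (x + k + 1) / ((k : ℚ) + 1) ^ 2) :=
  Finset.prod_range_succ _ _

theorem legendreTerm_neg_one_sub (k : ℕ) (x : ℚ) :
    legendreTerm k (-1 - x) = legendreTerm k x := by
  refine Finset.prod_congr rfl fun j _ => ?_
  congr 1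
  ring

theorem choose_mul_choose_div_eq_legendreTerm (k : ℕ) :
    ((2 * k).choose k : ℚ) * ((3 * k).choose k : ℚ) / (27 : ℚ) ^ k = legendreTerm k (-1 / 3) := by
  have key : ∀ k : ℕ, ((2 * k).choose k : ℚ) * ((3 * k).choose k : ℚ) =
      ((3 * k).factorial : ℚ) / (k.factorial : ℚ) ^ 3 := by
    intro k
    have h1 := Nat.choose_mul_factorial_mul_factorial (show k ≤ 2 * k by omega)
    have h2 := Nat.choose_mul_factorial_mul_factorial (show k ≤ 3 * k by omega)
    rw [show 2 * k - k = k by omega] at h1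
    rw [show 3 * k - k = 2 * k by omega, ← h1] at h2
    rw [← h2]
    have := Nat.factorial_ne_zero k
    push_cast
    field_simp
  rw [key]
  induction k with
  | zero => simp [legendreTerm]
  | succ k ih =>
    rw [legendreTerm_succ, ← ih, show 3 * (k + 1) = 3 * k + 1 + 1 + 1 by ring]
    simp only [Nat.factorial_succ]
    have := Nat.factorial_ne_zero k
    push_cast
    field_simp
    ring

theorem sum_mul_legendreTerm (n : ℕ) :
    ∑ k ∈ Finset.range n, (k : ℚ) * legendreTerm k (-1 / 3) =
      (n : ℚ) ^ 2 * legendreTerm n (-1 / 3) -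
        2 / 9 * ∑ k ∈ Finset.range n, legendreTerm k (-1 / 3) := by
  induction n with
  | zero => simp
  | succ n ih =>
    rw [Finset.sum_range_succ, ih, Finset.sum_range_succ, legendreTerm_succ]
    push_cast
    field_simp
    ring

theorem legendreTerm_add_one {x : ℚ} (hx : ∀ a : ℤ, x ≠ a) (k : ℕ) :
    legendreTerm k (x + 1) * (x + 1 - k) = legendreTerm k x * (x + k + 1) := by
  induction k with
  | zero => simp [legendreTerm]
  | succ k ih =>
    have h : x + 1 - k ≠ 0 := fun h => hx (k - 1) (by push_cast; linarith)
    rw [legendreTerm_succ, legendreTerm_succ]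
    have h' : legendreTerm k (x + 1) = legendreTerm k x * (x + k + 1) / (x + 1 - k) := by
      rw [eq_div_iff h, ih]
    rw [h']
    push_cast
    field_simp
    ring

/-- The sum of `legendreTerm k x` over `k ≤ n`. -/
def legendreSum (n : ℕ) (x : ℚ) : ℚ := ∑ k ∈ Finset.range (n + 1), legendreTerm k x

theorem legendreSum_add_legendreSum_add_one {x : ℚ} (hx : ∀ a : ℤ, x ≠ a) (n : ℕ) :
    legendreSum n x + legendreSum n (x + 1) =
      2 * legendreTerm n x * (x + n + 1) / (x + 1) := by
  have h1 : x + 1 ≠ 0 := fun h => hx (-1) (by push_cast; linarith)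
  induction n with
  | zero =>
    simp [legendreSum, legendreTerm]
    field_simp
    norm_num
  | succ n ih =>
    have e : ∀ y, legendreSum (n + 1) y = legendreSum n y + legendreTerm (n + 1) y :=
      fun y => Finset.sum_range_succ _ _
    have h : x - n ≠ 0 := fun h => hx n (by push_cast; linarith)
    have h' : legendreTerm (n + 1) (x + 1) =
        legendreTerm (n + 1) x * (x + n + 2) / (x - n) := by
      rw [eq_div_iff h]
      have := legendreTerm_add_one hx (n + 1)
      push_cast at this
      linear_combination this
    rw [e, e, h', add_add_add_comm, ih, legendreTerm_succ]
    push_cast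
    field_simp
    ring

section Choose

theorem sum_range_three_mul_ite (f : ℕ → ℚ) (n : ℕ) :
    ∑ k ∈ Finset.range (3 * n), (if 3 ∣ k then f k else 0) =
      ∑ j ∈ Finset.range n, f (3 * j) := by
  induction n with
  | zero => simp
  | succ n ih =>
    rw [show 3 * (n + 1) = 3 * n + 1 + 1 + 1 by ring, Finset.sum_range_succ,
      Finset.sum_range_succ, Finset.sum_range_succ, ih, Finset.sum_range_succ]
    rw [if_pos ⟨n, rfl⟩, if_neg (by omega), if_neg (by omega)]
    ring

theorem sum_choose_succ_mul_eq (f : ℕ → ℚ) (n : ℕ) :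
    ∑ k ∈ Finset.range (n + 2), ((n + 1).choose k : ℚ) * f k =
      ∑ k ∈ Finset.range (n + 1), (n.choose k : ℚ) * (f k + f (k + 1)) := by
  have h := Finset.sum_choose_succ_mul (fun i _ => f i) n
  rw [h, ← Finset.sum_add_distrib]
  exact Finset.sum_congr rfl fun k _ => by ring

theorem sum_choose_mul_period_three (n : ℕ) :
    ∀ r : ℕ, ∑ k ∈ Finset.range (6 * n + r + 1), ((6 * n + r).choose k : ℚ) *
        (if 3 ∣ k then 2 else -1) =
      ∑ k ∈ Finset.range (r + 1), (r.choose k : ℚ) * (if 3 ∣ k then 2 else -1) := by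
  induction n with
  | zero => intro r; simp
  | succ n ih =>
    intro r
    rw [show 6 * (n + 1) + r = 6 * n + r + 1 + 1 + 1 + 1 + 1 + 1 by ring, ← ih r]
    simp only [sum_choose_succ_mul_eq]
    refine Finset.sum_congr rfl fun k _ => ?_
    congr 1
    rcases (by omega : k % 3 = 0 ∨ k % 3 = 1 ∨ k % 3 = 2) with h | h | h <;>
      simp [Nat.dvd_iff_mod_eq_zero, Nat.add_mod, h] <;> norm_num

theorem sum_choose_mul_of_mod_six {n : ℕ} (hn : n % 6 = 1 ∨ n % 6 = 5) :
    ∑ k ∈ Finset.range (n + 1), (n.choose k : ℚ) * (if 3 ∣ k then 2 else -1) = 1 := by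
  have h := sum_choose_mul_period_three (n / 6) (n % 6)
  rw [Nat.div_add_mod] at h
  rw [h]
  rcases hn with h | h <;> rw [h] <;> norm_num [Finset.sum_range_succ, Nat.choose]

theorem sum_choose_three_mul {n : ℕ} (hn : n % 6 = 1 ∨ n % 6 = 5) :
    ∑ j ∈ Finset.range (n / 3 + 1), (n.choose (3 * j) : ℚ) = (2 ^ n + 1) / 3 := by
  have h1 : ∑ k ∈ Finset.range (n + 1), (n.choose k : ℚ) = 2 ^ n := by
    exact_mod_cast Nat.sum_range_choose n
  have h2 : ∑ k ∈ Finset.range (n + 1), (if 3 ∣ k then (n.choose k : ℚ) else 0) =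
      (2 ^ n + 1) / 3 := by
    rw [← h1, ← sum_choose_mul_of_mod_six hn, ← Finset.sum_add_distrib, Finset.sum_div]
    refine Finset.sum_congr rfl fun k _ => ?_
    split_ifs <;> ring
  rw [← h2, ← sum_range_three_mul_ite (fun k => (n.choose k : ℚ))]
  symm
  apply Finset.sum_subset
  · intro k
    simp only [Finset.mem_range]
    omega
  · intro k _ hk
    rw [Finset.mem_range, not_lt] at hk
    simp [Nat.choose_eq_zero_of_lt (show n < k by omega)]

theorem sum_choose_two_mul (n : ℕ) :
    ∑ j ∈ Finset.range (n + 1), ((2 * n + 1).choose (2 * j) : ℚ) = 2 ^ (2 * n) := by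
  have h : ∀ (N n : ℕ), ∑ j ∈ Finset.range (n + 1), ((N + 1).choose (2 * j) : ℚ) =
      ∑ k ∈ Finset.range (2 * n + 1), (N.choose k : ℚ) := by
    intro N n
    induction n with
    | zero => simp
    | succ n ih =>
      rw [Finset.sum_range_succ, ih, show 2 * (n + 1) = 2 * n + 1 + 1 by ring,
        Finset.sum_range_succ _ (2 * n + 1 + 1), Finset.sum_range_succ _ (2 * n + 1),
        Nat.choose_succ_succ]
      push_cast
      ring
  rw [h]
  exact_mod_cast Nat.sum_range_choose (2 * n)

end Choose

section Congruences

variable {p : ℕ}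

theorem pDvd_one_choose (hp : p.Prime) {k : ℕ} (h0 : 0 < k) (h1 : k < p) :
    PDvd p 1 (p.choose k : ℚ) := by
  obtain ⟨c, hc⟩ := hp.dvd_choose_self h0.ne' h1
  exact ⟨c, isPIntegral_natCast hp c, by rw [hc]; push_cast; ring⟩

theorem pDvd_two_choose_add (hp : p.Prime) {k : ℕ} (h0 : 0 < k) (h1 : k < p) :
    PDvd p 2 ((p.choose k : ℚ) + (-1) ^ k * (p / k)) := by
  induction k, h0 using Nat.le_induction with
  | base => simpa using pDvd_zero hp 2
  | succ k hk ih =>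
    have hk0 : (k : ℚ) ≠ 0 := by positivity
    have e : (p.choose (k + 1) : ℚ) = p.choose k * (p - k) / (k + 1) := by
      rw [eq_div_iff (by positivity)]
      have := Nat.choose_succ_right_eq p k
      rw [← Nat.cast_sub (by omega : k ≤ p)]
      exact_mod_cast this
    have hi := isPIntegral_inv_natCast (Nat.succ_pos k) h1
    have h2 := ((pDvd_one_self hp).mul hp (pDvd_one_choose hp hk (by omega))).mul_left hp hi
    have h3 := (((ih (by omega)).mul_left hp (isPIntegral_natCast hp k)).mul_left hp hi).neg
    convert h2.add hp h3 using 1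
    rw [e]
    push_cast
    field_simp
    ring

theorem pDvd_two_half_harmonic (hp : p.Prime) {n : ℕ} (hn : p = 2 * n + 1) :
    PDvd p 2 (2 ^ p - 2 + ∑ j ∈ Finset.range n, (p : ℚ) / (j + 1)) := by
  have h1 : PDvd p 2 (∑ j ∈ Finset.range n,
      ((p.choose (2 * (j + 1)) : ℚ) + (-1) ^ (2 * (j + 1)) * (p / (2 * (j + 1) : ℕ)))) := by
    refine PDvd.sum hp _ _ fun j hj => ?_
    rw [Finset.mem_range] at hj
    exact pDvd_two_choose_add hp (by omega) (by omega)
  have h2 := sum_choose_two_mul n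
  rw [Finset.sum_range_succ', ← hn] at h2
  rw [Finset.sum_add_distrib, eq_sub_of_add_eq h2] at h1
  convert h1.mul_left hp (isPIntegral_natCast hp 2) using 1
  rw [mul_add, Finset.mul_sum]
  congr 1
  · rw [hn, pow_succ]
    push_cast
    simp
    ring
  · refine Finset.sum_congr rfl fun j _ => ?_
    rw [pow_mul]
    push_cast
    field_simp
    simp

theorem pDvd_two_third_alternating (hp : p.Prime) (hp6 : p % 6 = 1 ∨ p % 6 = 5) :
    PDvd p 2 (2 ^ p - 2 + ∑ j ∈ Finset.range (p / 3), (-1) ^ (j + 1) * ((p : ℚ) / (j + 1))) := by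
  have h1 : PDvd p 2 (∑ j ∈ Finset.range (p / 3),
      ((p.choose (3 * (j + 1)) : ℚ) + (-1) ^ (3 * (j + 1)) * (p / (3 * (j + 1) : ℕ)))) := by
    refine PDvd.sum hp _ _ fun j hj => ?_
    rw [Finset.mem_range] at hj
    exact pDvd_two_choose_add hp (by omega) (by omega)
  have h2 := sum_choose_three_mul hp6
  rw [Finset.sum_range_succ'] at h2
  rw [Finset.sum_add_distrib, eq_sub_of_add_eq h2] at h1
  convert h1.mul_left hp (isPIntegral_natCast hp 3) using 1
  rw [mul_add, Finset.mul_sum]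
  congr 1
  · push_cast
    simp
    ring
  · refine Finset.sum_congr rfl fun j _ => ?_
    rw [pow_mul]
    push_cast
    field_simp

theorem PDvd.of_two (hp : p.Prime) {x : ℚ} (hx : PDvd p 2 x) : PDvd p 1 x := by
  obtain ⟨z, hz, rfl⟩ := hx
  exact ⟨p * z, (isPIntegral_natCast hp p).mul hp hz, by ring⟩

theorem isPIntegral_inv_three (hp3 : 3 < p) : IsPIntegral p ((3 : ℚ)⁻¹) := by
  simpa using isPIntegral_inv_natCast (k := 3) (by norm_num) hp3

theorem pDvd_one_third (hp : p.Prime) (hp3 : 3 < p) : PDvd p 1 ((p : ℚ) / 3) := by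
  convert (pDvd_one_self hp).mul_left hp (isPIntegral_inv_three hp3) using 1
  ring

theorem isPIntegral_third (hp : p.Prime) (hp3 : 3 < p) : IsPIntegral p ((p : ℚ) / 3) :=
  (pDvd_one_third hp hp3).isPIntegral hp

/-- Dividing by `a - p / 3` with `a` prime to `p` preserves divisibility by `p`. -/
theorem PDvd.of_mul_sub_third (hp : p.Prime) (hp3 : 3 < p) {n : ℕ} {a : ℤ}
    (ha : ¬ (p : ℤ) ∣ a) {x : ℚ} (h : PDvd p n (x * (a - p / 3))) : PDvd p n x := by
  have hb : ¬ (p : ℤ) ∣ 3 * a - p := by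
    rw [dvd_sub_self_right]
    intro h
    rcases (Nat.prime_iff_prime_int.mp hp).dvd_or_dvd h with h | h
    · exact not_dvd_of_pos_of_lt (p := p) (k := 3) (by norm_num) hp3 h
    · exact ha h
  have h0 : (3 * a - p : ℚ) ≠ 0 := by
    intro h0
    have : (3 * a - p : ℤ) = 0 := by exact_mod_cast h0
    exact hb (by simp [this])
  have hi := isPIntegral_div 3 hb
  convert h.mul_left hp hi using 1
  push_cast
  field_simp

theorem pDvd_two_legendreTerm_neg_third (hp : p.Prime) (hp3 : 3 < p) {k : ℕ} (h0 : 0 < k)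
    (h1 : k < p) : PDvd p 2 (legendreTerm k (-((p : ℚ) / 3)) - p / 3 / k) := by
  have hs := pDvd_one_third hp hp3
  induction k, h0 using Nat.le_induction with
  | base =>
    convert (hs.mul hp hs).neg using 1
    simp [legendreTerm]
    ring
  | succ k hk ih =>
    have hk0 : (k : ℚ) ≠ 0 := by positivity
    have hi := isPIntegral_inv_natCast (Nat.succ_pos k) h1
    have ih := ih (by omega)
    have hw : PDvd p 1 (legendreTerm k (-((p : ℚ) / 3))) := by
      convert (ih.of_two hp).add hp
        (hs.mul_left hp (isPIntegral_inv_natCast hk (by omega))) using 1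
      ring
    have h2 := (ih.mul_left hp (isPIntegral_natCast hp k)).mul_left hp hi
    have h3 := (hw.mul hp hs).mul_left hp
      (((isPIntegral_natCast hp 1).add hp (isPIntegral_third hp hp3).neg).mul hp (hi.mul hp hi))
    convert h2.add hp h3 using 1
    rw [legendreTerm_succ]
    push_cast
    field_simp
    ring

theorem ne_intCast_natCast_sub_third (hp : p.Prime) (hp3 : 3 < p) (i : ℕ) (a : ℤ) :
    (i : ℚ) - p / 3 ≠ a := by
  intro h
  have h1 : (p : ℚ) = ((3 * (i - a) : ℤ) : ℚ) := by push_cast; linarith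
  have h2 : (p : ℤ) = 3 * (i - a) := by exact_mod_cast h1
  have h3 : 3 ∣ p := by omega
  rcases hp.eq_one_or_self_of_dvd 3 h3 with h | h <;> omega

theorem pDvd_two_legendreTerm_half (hp : p.Prime) (hp3 : 3 < p) {n : ℕ} (hn : p = 2 * n + 1)
    {i : ℕ} (hi : i < n) :
    PDvd p 1 (legendreTerm n (i - (p : ℚ) / 3)) ∧
      PDvd p 2 ((2 * i + 1) * legendreTerm n (i - (p : ℚ) / 3) + 2 * (p / 3)) := by
  have hs := pDvd_one_third hp hp3
  have hp' := pDvd_one_self hp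
  have hnp : (p : ℚ) = 2 * n + 1 := by exact_mod_cast hn
  induction i with
  | zero =>
    have hn0 : (n : ℚ) ≠ 0 := by
      have : 0 < n := hi
      positivity
    have hni := isPIntegral_inv_natCast (p := p) hi (by omega)
    have h := pDvd_two_legendreTerm_neg_third hp hp3 hi (by omega)
    constructor
    · convert (h.of_two hp).add hp (hs.mul_left hp hni) using 1
      simp
      ring
    · convert h.add hp ((hs.mul hp hp').mul_left hp hni) using 1
      simp only [Nat.cast_zero, zero_sub]
      field_simp
      rw [hnp]
      ring
  | succ i ih =>
    obtain ⟨ih1, ih2⟩ := ih (by omega)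
    have hr := legendreTerm_add_one (ne_intCast_natCast_sub_third hp hp3 i) n
    have hx : ((i + 1 : ℕ) : ℚ) - p / 3 = i - p / 3 + 1 := by push_cast; ring
    rw [hx]
    set w := legendreTerm n ((i : ℚ) - p / 3)
    set w' := legendreTerm n ((i : ℚ) - p / 3 + 1)
    have h1 : PDvd p 1 w' := by
      have ha : ¬ (p : ℤ) ∣ (i : ℤ) + 1 - n := by
        rw [← dvd_neg, show -((i : ℤ) + 1 - n) = ((n - (i + 1) : ℕ) : ℤ) by omega]
        exact not_dvd_of_pos_of_lt (by omega) (by omega)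
      refine PDvd.of_mul_sub_third hp hp3 ha ?_
      have hc : IsPIntegral p ((i : ℚ) - p / 3 + n + 1) := by
        convert (isPIntegral_natCast hp (i + n + 1)).add hp (isPIntegral_third hp hp3).neg using 1
        push_cast
        ring
      convert ih1.mul_left hp hc using 1
      push_cast
      linear_combination hr
    refine ⟨h1, ?_⟩
    have h2 := ih1.mul hp (hs.add hp hp'.neg).neg
    have h3 := ih1.mul hp hs
    have h4 := h1.mul hp ((hs.add hp hs).add hp hp')
    convert ((ih2.add hp h2).add hp h3.neg).add hp h4 using 1
    push_cast
    rw [hnp] at hr ⊢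
    linear_combination 2 * hr

theorem pDvd_two_legendreSum_neg_third (hp : p.Prime) (hp3 : 3 < p) {n : ℕ}
    (hn : p = 2 * n + 1) :
    PDvd p 2 (legendreSum n (-((p : ℚ) / 3)) - 1 + (2 ^ p - 2) / 3) := by
  have h1 : PDvd p 2 (∑ j ∈ Finset.range n,
      (legendreTerm (j + 1) (-((p : ℚ) / 3)) - p / 3 / (j + 1 : ℕ))) := by
    refine PDvd.sum hp _ _ fun j hj => ?_
    rw [Finset.mem_range] at hj
    exact pDvd_two_legendreTerm_neg_third hp hp3 (by omega) (by omega)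
  convert h1.add hp ((pDvd_two_half_harmonic hp hn).mul_left hp
    (isPIntegral_inv_three hp3)) using 1
  have h2 : ∑ j ∈ Finset.range n, (p : ℚ) / 3 / (j + 1 : ℕ) =
      3⁻¹ * ∑ j ∈ Finset.range n, (p : ℚ) / (j + 1) := by
    rw [Finset.mul_sum]
    exact Finset.sum_congr rfl fun j _ => by push_cast; ring
  rw [legendreSum, Finset.sum_range_succ', legendreTerm_zero, Finset.sum_sub_distrib, h2]
  ring

theorem pDvd_two_legendreSum_shift (hp : p.Prime) (hp3 : 3 < p) {n : ℕ} (hn : p = 2 * n + 1)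
    {i : ℕ} (hi : i < n) :
    PDvd p 2 ((-1) ^ i * legendreSum n (i - (p : ℚ) / 3) - legendreSum n (-((p : ℚ) / 3)) +
      2 / 3 * ∑ j ∈ Finset.range i, (-1) ^ (j + 1) * ((p : ℚ) / (j + 1))) := by
  have hs := pDvd_one_third hp hp3
  have hp' := pDvd_one_self hp
  have hnp : (p : ℚ) = 2 * n + 1 := by exact_mod_cast hn
  induction i with
  | zero => simpa using pDvd_zero hp 2
  | succ i ih =>
    have ih := ih (by omega)
    obtain ⟨h1, h2⟩ := pDvd_two_legendreTerm_half hp hp3 hn (by omega : i < n)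
    have hne := ne_intCast_natCast_sub_third hp hp3 i
    have hx : ((i + 1 : ℕ) : ℚ) - p / 3 = i - p / 3 + 1 := by push_cast; ring
    have hr := legendreSum_add_legendreSum_add_one hne n
    rw [hx, Finset.sum_range_succ]
    set w := legendreTerm n ((i : ℚ) - p / 3)
    set G := 2 * w * (i - (p : ℚ) / 3 + n + 1) / (i - p / 3 + 1) with hG
    have hG' : G * (i - p / 3 + 1) = 2 * w * (i - (p : ℚ) / 3 + n + 1) := by
      rw [hG, div_mul_cancel₀]
      intro h
      exact hne (-1) (by push_cast; linarith)
    have h3 : PDvd p 1 G := by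
      have ha : ¬ (p : ℤ) ∣ ((i + 1 : ℕ) : ℤ) := not_dvd_of_pos_of_lt (by omega) (by omega)
      refine PDvd.of_mul_sub_third hp hp3 ha ?_
      have hc : IsPIntegral p (2 * ((i : ℚ) - p / 3 + n + 1)) := by
        convert (isPIntegral_natCast hp 2).mul hp
          ((isPIntegral_natCast hp (i + n + 1)).add hp (isPIntegral_third hp hp3).neg) using 1
        push_cast
        ring
      convert h1.mul_left hp hc using 1
      push_cast
      linear_combination hG'
    have h4 : PDvd p 2 ((i + 1) * G + 2 * (p / 3)) := by
      convert ((h2.add hp (h1.mul hp (hp'.add hp (hs.add hp hs).neg))).add hp (hs.mul hp h3))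
        using 1
      rw [hnp] at hG' ⊢
      linear_combination hG'
    have h5 := (h4.mul_left hp (isPIntegral_inv_natCast (Nat.succ_pos i)
      (by omega))).mul_left hp (isPIntegral_intCast hp ((-1) ^ (i + 1)))
    convert ih.add hp h5 using 1
    rw [← eq_sub_iff_add_eq'] at hr
    rw [hr]
    push_cast
    field_simp
    ring

theorem pDvd_two_legendreSum (hp : p.Prime) (hp3 : 3 < p) {n : ℕ} (hn : p = 2 * n + 1)
    (hp6 : p % 6 = 1 ∨ p % 6 = 5) :
    PDvd p 2 ((-1) ^ (p / 3) * legendreSum n ((p / 3 : ℕ) - (p : ℚ) / 3) - (2 ^ p + 1) / 3) := by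
  have h1 := pDvd_two_legendreSum_shift hp hp3 hn (i := p / 3) (by omega)
  have h2 := pDvd_two_legendreSum_neg_third hp hp3 hn
  have h3 := (pDvd_two_third_alternating hp hp6).mul_left hp
    ((isPIntegral_natCast hp 2).mul hp (isPIntegral_inv_three hp3))
  convert (h1.add hp h2).add hp h3.neg using 1
  push_cast
  ring

theorem legendreSym_three_eq (hp6 : p % 6 = 1 ∨ p % 6 = 5) :
    legendreSym 3 (p : ℤ) = (-1) ^ (p / 3) := by
  rw [legendreSym.mod]
  rcases hp6 with h | h
  · rw [Even.neg_one_pow (Nat.even_iff.2 (by omega)),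
      show (p : ℤ) % (3 : ℕ) = 1 by omega]
    decide
  · rw [Odd.neg_one_pow (Nat.odd_iff.2 (by omega)),
      show (p : ℤ) % (3 : ℕ) = 2 by omega]
    decide

end Congruences

theorem theorem3p5 (p : ℕ) (hp : p.Prime) (hp3 : 3 < p) :
    PCongr p 2
      (∑ k ∈ Finset.range ((p - 1) / 2 + 1),
        (k : ℚ) * ((2 * k).choose k : ℚ) * ((3 * k).choose k : ℚ) / (27 : ℚ) ^ k)
      (-(legendreSym 3 (p : ℤ) : ℚ) * ((4 - 3 * (p : ℚ) + 2 ^ (p + 2)) / 54)) := by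
  have hp2 : p % 2 = 1 := hp.eq_two_or_odd.resolve_left (by omega)
  have hp3' : p % 3 ≠ 0 := fun h => by
    rcases hp.eq_one_or_self_of_dvd 3 (Nat.dvd_of_mod_eq_zero h) with h | h <;> omega
  have hp6 : p % 6 = 1 ∨ p % 6 = 5 := by omega
  obtain ⟨n, hn⟩ : ∃ n, p = 2 * n + 1 := ⟨p / 2, by omega⟩
  have hnp : (p : ℚ) = 2 * n + 1 := by exact_mod_cast hn
  have hN : (p - 1) / 2 = n := by omega
  have hw := (pDvd_two_legendreTerm_half hp hp3 hn (i := p / 3) (by omega)).1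
  have hE := (pDvd_two_legendreTerm_half hp hp3 hn (i := p / 3) (by omega)).2
  have hF := pDvd_two_legendreSum hp hp3 hn hp6
  rw [legendreSym_three_eq hp6, hN]
  set a : ℚ := (p / 3 : ℕ) - (p : ℚ) / 3 with ha
  set δ : ℤ := (-1) ^ (p / 3) with hδ
  have hδF : ((-1) ^ (p / 3) : ℚ) = δ := by rw [hδ]; push_cast; rfl
  rw [hδF] at hF
  have hδa : (δ : ℚ) ^ 2 = 1 ∧ a = δ / 6 - 1 / 2 ∧
      ∀ k, legendreTerm k a = legendreTerm k (-1 / 3) := by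
    have hm := Nat.div_add_mod p 3
    have hm' : (p : ℚ) = 3 * (p / 3 : ℕ) + (p % 3 : ℕ) := by exact_mod_cast hm.symm
    rcases hp6 with h | h
    · have h1 : δ = 1 := Even.neg_one_pow (Nat.even_iff.2 (by omega))
      rw [show p % 3 = 1 by omega] at hm'
      have h2 : a = -1 / 3 := by rw [ha]; push_cast at hm' ⊢; linarith
      refine ⟨by simp [h1], by rw [h1, h2]; norm_num, fun k => by rw [h2]⟩
    · have h1 : δ = -1 := Odd.neg_one_pow (Nat.odd_iff.2 (by omega))
      rw [show p % 3 = 2 by omega] at hm'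
      have h2 : a = -1 - -1 / 3 := by rw [ha]; push_cast at hm' ⊢; linarith
      refine ⟨by simp [h1], by rw [h1, h2]; norm_num, fun k => by
        rw [h2, legendreTerm_neg_one_sub]⟩
  obtain ⟨hδ2, haδ, hterm⟩ := hδa
  have hsum : ∑ k ∈ Finset.range (n + 1),
      (k : ℚ) * ((2 * k).choose k : ℚ) * ((3 * k).choose k : ℚ) / (27 : ℚ) ^ k =
      legendreTerm n a * (n - a) * (a + n + 1) - 2 / 9 * legendreSum n a := by
    have h1 := sum_mul_legendreTerm (n + 1)
    simp only [← hterm] at h1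
    rw [legendreTerm_succ] at h1
    have h2 : ∀ k : ℕ, (k : ℚ) * ((2 * k).choose k : ℚ) * ((3 * k).choose k : ℚ) / (27 : ℚ) ^ k =
        k * legendreTerm k a := fun k => by
      rw [hterm, ← choose_mul_choose_div_eq_legendreTerm]
      ring
    simp only [h2]
    rw [h1, legendreSum]
    push_cast
    field_simp
  rw [hsum]
  have hδi := isPIntegral_intCast hp δ
  have i2 : IsPIntegral p ((2 : ℚ)⁻¹) := by
    simpa using isPIntegral_inv_natCast (k := 2) (by norm_num) (by omega)
  have i3 := isPIntegral_inv_three hp3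
  have hp' := pDvd_one_self hp
  have hR : IsPIntegral p (-((δ : ℤ) : ℚ) * ((4 - 3 * (p : ℚ) + 2 ^ (p + 2)) / 54)) := by
    convert (hδi.mul hp (isPIntegral_intCast hp (4 - 3 * p + 2 ^ (p + 2)))).neg.mul hp
      (i2.mul hp (i3.mul hp (i3.mul hp i3))) using 1
    push_cast
    ring
  have hdiff : PDvd p 2 (legendreTerm n a * (n - a) * (a + n + 1) - 2 / 9 * legendreSum n a -
      -((δ : ℤ) : ℚ) * ((4 - 3 * (p : ℚ) + 2 ^ (p + 2)) / 54)) := by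
    have h1 := (hp'.mul hp hp').mul_left hp ((hw.isPIntegral hp).mul hp (i2.mul hp i2))
    have h2 := (hE.add hp ((hw.mul hp (pDvd_one_third hp hp3)).mul_left hp
      (isPIntegral_natCast hp 2)).neg).mul_left hp (hδi.mul hp (i2.mul hp (i2.mul hp i3)))
    have h3 := hF.mul_left hp
      ((isPIntegral_natCast hp 2).mul hp ((i3.mul hp i3).mul hp hδi))
    convert (h1.add hp h2.neg).add hp h3.neg using 1
    have hm : ((p / 3 : ℕ) : ℚ) = a + p / 3 := by rw [ha]; ring
    have hn' : (n : ℚ) = (p - 1) / 2 := by rw [hnp]; ring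
    rw [hm, haδ, hn']
    generalize legendreTerm n _ = w
    generalize legendreSum n _ = F
    push_cast
    rw [pow_add]
    linear_combination (2 / 9 * F) * hδ2
  refine ⟨?_, hR, hdiff⟩
  simpa using (hdiff.isPIntegral hp).add hp hR
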